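/- Let $d\ge 1$ and $\lambda>0$, and let $\Phi$ be a homogeneous Poisson point process of intensity $\lambda$ on $\mathbb{R}^d$ (with the Euclidean norm). For $\mathbf{x}\in\Phi$ let $V_{\mathbf{x}}=\{\mathbf{y}\in\mathbb{R}^d : \|\mathbf{y}-\mathbf{x}\|\le\|\mathbf{x}'-\mathbf{y}\|\ \text{for all } \mathbf{x}'\in\Phi\}$ be its Voronoi cell. Almost surely there is a unique $\mathbf{x}_o\in\Phi$ with $o\in V_{\mathbf{x}_o}$, where $o$ is the origin; the cell $\tilde V_o=V_{\mathbf{x}_o}$ is called the 0-cell, and almost surely its volume is positive and finite. Let $\mathbf{Y}$ be a uniformly random point in the 0-cell, that is, a random vector whose conditional distribution given $\Phi$ is the normalised Lebesgue measure on $\tilde V_o$, and let $\tilde R_o=\|\mathbf{x}_o-\mathbf{Y}\|$ be its distance from the nucleus. Then the cumulative distribution function of $\tilde R_o$ is $$F_{\tilde R_o}(r)=1-\exp\left(-\lambda\kappa_d r^d\right),\qquad r\ge 0,$$ where $\kappa_d=\pi^{d/2}/\Gamma\left(\frac d2+1\right)$ is the volume of the unit ball of $\mathbb{R}^d$. -/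

import Mathlib

open MeasureTheory ProbabilityTheory
open scoped NNReal

noncomputable section

namespace PoissonVoronoi

/-- `ℝ^d` with the Euclidean norm. -/
abbrev Space (d : ℕ) : Type := EuclideanSpace ℝ (Fin d)

/-- The standard σ-algebra on point configurations in `ℝ^d`: the smallest one for which the number
of points in each bounded Borel set is measurable. -/
@[reducible] def configSigma (d : ℕ) : MeasurableSpace (Set (Space d)) :=
  ⨆ (B : Set (Space d)) (_ : MeasurableSet B) (_ : Bornology.IsBounded B),
    MeasurableSpace.comap (fun S : Set (Space d) => (S ∩ B).encard) inferInstance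

/-- The σ-algebra generated by a random point configuration `Φ`. -/
@[reducible] def sigmaOf {d : ℕ} {Ω : Type*} (Φ : Ω → Set (Space d)) : MeasurableSpace Ω :=
  MeasurableSpace.comap Φ (configSigma d)

/-- `Φ` is a homogeneous Poisson point process on `ℝ^d` with intensity `l`, under `P`: a random,
almost surely locally finite set of points, whose number of points in a bounded Borel set `B` is
Poisson distributed with mean `l · vol(B)`, and whose numbers of points in disjoint bounded Borel
sets are independent. -/
structure IsHomogeneousPPP {d : ℕ} {Ω : Type*} [MeasurableSpace Ω] (P : Measure Ω)
    (Φ : Ω → Set (Space d)) (l : ℝ≥0) : Prop where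
  measurable : sigmaOf Φ ≤ ‹MeasurableSpace Ω›
  locallyFinite : ∀ᵐ ω ∂P, ∀ B : Set (Space d), Bornology.IsBounded B → (Φ ω ∩ B).Finite
  law_count : ∀ B : Set (Space d), MeasurableSet B → Bornology.IsBounded B →
    P.map (fun ω => (Φ ω ∩ B).encard) =
      (poissonMeasure (l * (volume B).toNNReal)).map (Nat.cast : ℕ → ℕ∞)
  indep_count : ∀ (n : ℕ) (B : Fin n → Set (Space d)),
    (∀ i, MeasurableSet (B i)) → (∀ i, Bornology.IsBounded (B i)) →
    Pairwise (fun i j => Disjoint (B i) (B j)) →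
    iIndepFun (fun (i : Fin n) (ω : Ω) => (Φ ω ∩ B i).encard) P

/-- The Voronoi cell with nucleus `x` with respect to the configuration `S`. -/
def voronoiCell {d : ℕ} (S : Set (Space d)) (x : Space d) : Set (Space d) :=
  {y | ∀ x' ∈ S, ‖y - x‖ ≤ ‖x' - y‖}

open Classical in
/-- The nucleus of the 0-cell: a point of `S` whose Voronoi cell contains the origin (the value `0`
is used if there is none). For a homogeneous Poisson point process of positive intensity
there is almost surely exactly one such point. -/
def zeroNucleus {d : ℕ} (S : Set (Space d)) : Space d :=
  if h : ∃ x, x ∈ S ∧ (0 : Space d) ∈ voronoiCell S x then h.choose else 0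

/-- The 0-cell: the Voronoi cell containing the origin. -/
def zeroCell {d : ℕ} (S : Set (Space d)) : Set (Space d) :=
  voronoiCell S (zeroNucleus S)

/-- `Y` is a uniformly random point in the 0-cell of `Φ`: given `Φ`, the conditional distribution
of `Y` is the normalised Lebesgue measure on the 0-cell, that is, for every Borel set `A`,
`P(Y ∈ A | Φ) = vol(A ∩ V) / vol(V)` almost surely, `V` being the 0-cell. -/
def IsUniformInZeroCell {d : ℕ} {Ω : Type*} [MeasurableSpace Ω] (P : Measure Ω)
    (Φ : Ω → Set (Space d)) (Y : Ω → Space d) : Prop :=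
  Measurable Y ∧ ∀ A : Set (Space d), MeasurableSet A →
    P[(Y ⁻¹' A).indicator (fun _ => (1 : ℝ)) | sigmaOf Φ] =ᵐ[P]
      fun ω => (volume (A ∩ zeroCell (Φ ω)) / volume (zeroCell (Φ ω))).toReal

/-- The distance from the nucleus of the 0-cell of `Φ` to the point `Y`. -/
def zeroCellDist {d : ℕ} {Ω : Type*} (Φ : Ω → Set (Space d)) (Y : Ω → Space d) (ω : Ω) : ℝ :=
  ‖zeroNucleus (Φ ω) - Y ω‖

/-- The volume `π^(d/2) / Γ(d/2 + 1)` of the unit ball in `ℝ^d`. -/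
def kappa (d : ℕ) : ℝ := Real.pi ^ ((d : ℝ) / 2) / Real.Gamma ((d : ℝ) / 2 + 1)

end PoissonVoronoi

end

/-!
Almost surely, `Y` lies in the 0-cell, so its distance to the nucleus is its distance to `Φ`, and
the claim says that the distance from `Y` to `Φ` has the same law as the distance from the origin to
`Φ`; the latter exceeds `r` exactly when the closed ball of radius `r` is void.

The two laws agree by mass transport, with no recourse to Palm calculus
(`IsHomogeneousPPP.measure_lt_infEDist_uniform`). Let every point `x` of the space spread a unit
mass uniformly over the Voronoi cell containing `x`, and keep only the mass that arrives at points
`y` at distance more than `r` from `Φ`. The expected mass leaving the origin is the probability that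
`Y` is at distance more than `r` from `Φ` (`IsHomogeneousPPP.lintegral_uniform`). By Tonelli's
theorem and stationarity it equals the expected mass arriving at the origin. The origin receives
total mass one, because all points of its cell have the same cell (`lintegral_cellDensity_zero`), so
the latter is the probability that the origin is at distance more than `r` from `Φ`.

Stationarity only concerns functionals of the configuration that are measurable for the σ-algebra
generated by void events `{S | S ∩ B = ∅}`. These form a π-system, so translation invariance of the
void probabilities suffices (`IsHomogeneousPPP.map_shift`). All functionals in use are built from
infima `⨅ s ∈ S, g s`, which are measurable for this σ-algebra (`measurable_iInf_config`): the
distance to `S`, and the relation `ShareNucleus S x y` that `x` and `y` have a common nearest point.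

The almost sure properties of the 0-cell come from the same tools. For a fixed locally finite
configuration the points with two nearest neighbours lie on countably many hyperplanes, hence by
Tonelli and stationarity the origin almost surely is not one of them
(`IsHomogeneousPPP.ae_not_nearestTie_zero`). The expected volume of the 0-cell is the integral over
`y` of the probability that `0` and `y` share a nucleus, which decays like `exp (-c * ‖y‖ ^ d)`
(`IsHomogeneousPPP.ae_cellVolume_zero_lt_top`).
-/

open scoped ENNReal

noncomputable section

namespace PoissonVoronoi

/-! ### Void events and measurable functionals of a configuration -/

/-- Point configurations, wrapped in a structure so that they carry the σ-algebra generated by the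
void events rather than the one Mathlib puts on `Set`. -/
structure Config (d : ℕ) where
  /-- The set of points of the configuration. -/
  points : Set (Space d)

/-- The events that a given bounded Borel set contains no point of the configuration. -/
def voidEvents (d : ℕ) : Set (Set (Config d)) :=
  {E | ∃ B : Set (Space d), MeasurableSet B ∧ Bornology.IsBounded B ∧
    E = {S : Config d | S.points ∩ B = ∅}}

instance (d : ℕ) : MeasurableSpace (Config d) := MeasurableSpace.generateFrom (voidEvents d)

variable {d : ℕ}

theorem isPiSystem_voidEvents : IsPiSystem (voidEvents d) := by
  rintro _ ⟨B, hB, hB', rfl⟩ _ ⟨C, hC, hC', rfl⟩ -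
  refine ⟨B ∪ C, hB.union hC, hB'.union hC', ?_⟩
  ext S
  simp [Set.inter_union_distrib_left]

theorem measurableSet_void {B : Set (Space d)} (hB : MeasurableSet B) :
    MeasurableSet {S : Config d | S.points ∩ B = ∅} := by
  have : {S : Config d | S.points ∩ B = ∅} =
      ⋂ n : ℕ, {S : Config d | S.points ∩ (B ∩ Metric.ball 0 n) = ∅} := by
    ext S
    simp only [Set.mem_iInter, Set.mem_ofPred_eq]
    rw [← Set.iUnion_eq_empty, ← Set.inter_iUnion, ← Set.inter_iUnion, Metric.iUnion_ball_nat,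
      Set.inter_univ]
  rw [this]
  exact MeasurableSet.iInter fun n => MeasurableSpace.measurableSet_generateFrom
    ⟨_, hB.inter measurableSet_ball, Metric.isBounded_ball.subset Set.inter_subset_right, rfl⟩

/-- The infimum over the configuration lies below `r` exactly when the sublevel set `{g < r}` is
not void. -/
theorem measurable_iInf_config {g : Space d → ℝ≥0∞} (hg : Measurable g) :
    Measurable fun S : Config d => ⨅ s ∈ S.points, g s := by
  refine measurable_of_Iio fun r => ?_
  have : (fun S : Config d => ⨅ s ∈ S.points, g s) ⁻¹' Set.Iio r =
      {S : Config d | S.points ∩ {s | g s < r} = ∅}ᶜ := by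
    ext S
    simp [iInf_lt_iff, ← Set.nonempty_iff_ne_empty, Set.Nonempty]
  rw [this]
  exact (measurableSet_void (measurableSet_lt hg measurable_const)).compl

/-- The least value of `edist x s + edist y s` over the points `s` of `S`. -/
def pairDist (S : Set (Space d)) (x y : Space d) : ℝ≥0∞ := ⨅ s ∈ S, (edist x s + edist y s)

theorem measurable_infEDist_inter {F : Set (Space d)} (hF : MeasurableSet F) :
    Measurable fun p : Space d × Config d => Metric.infEDist p.1 (p.2.points ∩ F) := by
  refine measurable_uncurry_of_continuous_of_measurable
    (u := fun (y : Space d) (S : Config d) => Metric.infEDist y (S.points ∩ F))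
    (fun S => Metric.continuous_infEDist) fun y => ?_
  have h : Measurable fun s => edist y s + Set.indicator Fᶜ (fun _ => (⊤ : ℝ≥0∞)) s :=
    (measurable_edist_right).add (measurable_const.indicator hF.compl)
  convert measurable_iInf_config h using 2 with S
  refine le_antisymm ?_ ?_
  · refine le_iInf₂ fun s hs => ?_
    by_cases hsF : s ∈ F
    · have h' : s ∈ S.points ∩ F := ⟨hs, hsF⟩
      simpa [hsF] using Metric.infEDist_le_edist_of_mem (x := y) h'
    · simp [hsF]
  · refine le_iInf₂ fun s hs => iInf₂_le_of_le s hs.1 ?_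
    have : s ∈ F := hs.2
    simp [this]

theorem measurable_infEDist_config :
    Measurable fun p : Space d × Config d => Metric.infEDist p.1 p.2.points := by
  have h := measurable_infEDist_inter (d := d) MeasurableSet.univ
  simp only [Set.inter_univ] at h
  exact h

theorem measurable_pairDist :
    Measurable fun p : (Space d × Space d) × Config d => pairDist p.2.points p.1.1 p.1.2 := by
  refine measurable_uncurry_of_continuous_of_measurable
    (u := fun (q : Space d × Space d) (S : Config d) => pairDist S.points q.1 q.2) (fun S => ?_)
    fun q => measurable_iInf_config (by fun_prop)
  refine continuous_of_le_add_edist 2 (by simp) fun p q => ?_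
  rw [pairDist, pairDist, ENNReal.iInf_add]
  refine le_iInf fun s => ?_
  rw [ENNReal.iInf_add]
  refine le_iInf fun hs => iInf₂_le_of_le s hs ?_
  calc edist p.1 s + edist p.2 s
      ≤ (edist p.1 q.1 + edist q.1 s) + (edist p.2 q.2 + edist q.2 s) :=
        add_le_add (edist_triangle _ _ _) (edist_triangle _ _ _)
    _ = (edist q.1 s + edist q.2 s) + (edist p.1 q.1 + edist p.2 q.2) := by ring
    _ ≤ (edist q.1 s + edist q.2 s) + 2 * edist p q := by
        rw [two_mul]
        gcongr
        · exact le_max_left _ _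
        · exact le_max_right _ _

/-- `x` and `y` have a common nearest point in `S`. The equation says this for a nonempty locally
finite `S`, and makes the relation visibly measurable in `(x, y, S)`. -/
def ShareNucleus (S : Set (Space d)) (x y : Space d) : Prop :=
  pairDist S x y = Metric.infEDist x S + Metric.infEDist y S

theorem measurableSet_shareNucleus :
    MeasurableSet {p : (Space d × Space d) × Config d | ShareNucleus p.2.points p.1.1 p.1.2} :=
  measurableSet_eq_fun measurable_pairDist
    ((measurable_infEDist_config.comp (by fun_prop : Measurable
        fun p : (Space d × Space d) × Config d => (p.1.1, p.2))).add
      (measurable_infEDist_config.comp (by fun_prop : Measurable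
        fun p : (Space d × Space d) × Config d => (p.1.2, p.2))))

/-- The volume of the set of points that share a nucleus with `x`. -/
def cellVolume (S : Set (Space d)) (x : Space d) : ℝ≥0∞ := volume {y | ShareNucleus S x y}

theorem measurable_cellVolume :
    Measurable fun p : Space d × Config d => cellVolume p.2.points p.1 :=
  measurable_measure_prodMk_left (ν := (volume : Measure (Space d)))
    (s := {q : (Space d × Config d) × Space d | ShareNucleus q.1.2.points q.1.1 q.2})
    (measurableSet_shareNucleus.preimage (by fun_prop : Measurable
      fun q : (Space d × Config d) × Space d => ((q.1.1, q.2), q.1.2)))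

open Classical in
/-- The density at `y` of the uniform distribution on the cell of `x`. -/
def cellDensity (S : Set (Space d)) (x y : Space d) : ℝ≥0∞ :=
  if ShareNucleus S x y then (cellVolume S x)⁻¹ else 0

theorem measurable_cellDensity :
    Measurable fun p : (Space d × Space d) × Config d => cellDensity p.2.points p.1.1 p.1.2 :=
  Measurable.ite measurableSet_shareNucleus
    (measurable_cellVolume.comp (by fun_prop : Measurable
      fun p : (Space d × Space d) × Config d => (p.1.1, p.2))).inv measurable_const

/-! ### Translations -/

/-- The configuration `S - z`. -/
def shift (z : Space d) (S : Set (Space d)) : Set (Space d) := (fun s => s + z) ⁻¹' S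

theorem shift_inter_eq_empty (z : Space d) (S B : Set (Space d)) :
    shift z S ∩ B = ∅ ↔ S ∩ ((fun s => s - z) ⁻¹' B) = ∅ := by
  have : shift z S ∩ B = (fun s => s + z) ⁻¹' (S ∩ ((fun s => s - z) ⁻¹' B)) := by
    ext s
    simp [shift]
  have hr : Set.range (fun s : Space d => s + z) = Set.univ :=
    (Equiv.addRight z).surjective.range_eq
  rw [this, Set.preimage_eq_empty_iff, hr, Set.disjoint_univ]

theorem infEDist_shift (z y : Space d) (S : Set (Space d)) :
    Metric.infEDist y (shift z S) = Metric.infEDist (y + z) S := by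
  refine Equiv.iInf_congr (Equiv.addRight z) fun s => ?_
  simp [shift]

theorem pairDist_shift (z x y : Space d) (S : Set (Space d)) :
    pairDist (shift z S) x y = pairDist S (x + z) (y + z) := by
  refine Equiv.iInf_congr (Equiv.addRight z) fun s => ?_
  simp [shift]

theorem shareNucleus_shift (z x y : Space d) (S : Set (Space d)) :
    ShareNucleus (shift z S) x y ↔ ShareNucleus S (x + z) (y + z) := by
  simp only [ShareNucleus, infEDist_shift, pairDist_shift]

theorem cellVolume_shift (z x : Space d) (S : Set (Space d)) :
    cellVolume (shift z S) x = cellVolume S (x + z) := by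
  simp only [cellVolume, shareNucleus_shift]
  exact measure_preimage_add_right volume z {y | ShareNucleus S (x + z) y}

theorem cellDensity_shift (z x y : Space d) (S : Set (Space d)) :
    cellDensity (shift z S) x y = cellDensity S (x + z) (y + z) := by
  classical
  simp only [cellDensity, cellVolume_shift]
  exact if_congr (shareNucleus_shift z x y S) rfl rfl

theorem measurable_shift (z : Space d) :
    Measurable fun S : Config d => Config.mk (shift z S.points) := by
  refine measurable_generateFrom ?_
  rintro _ ⟨B, hB, -, rfl⟩
  have : (fun S : Config d => Config.mk (shift z S.points)) ⁻¹'
      {S : Config d | S.points ∩ B = ∅} =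
      {S : Config d | S.points ∩ ((fun s => s - z) ⁻¹' B) = ∅} := by
    ext S
    simp only [Set.mem_preimage, Set.mem_ofPred_eq, shift_inter_eq_empty]
  rw [this]
  exact measurableSet_void (hB.preimage (by fun_prop))

/-! ### Nearest points in a locally finite configuration -/

/-- A coercive function attains its minimum on a nonempty locally finite set. -/
theorem exists_forall_le_of_locallyFinite {S : Set (Space d)} (hne : S.Nonempty)
    (hfin : ∀ B, Bornology.IsBounded B → (S ∩ B).Finite) {y : Space d} {g : Space d → ℝ≥0∞}
    (hg : ∀ s, edist y s ≤ g s) (hg' : ∀ s, g s ≠ ⊤) : ∃ s ∈ S, ∀ t ∈ S, g s ≤ g t := by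
  obtain ⟨s₀, hs₀⟩ := hne
  have hB : Bornology.IsBounded {s | g s ≤ g s₀} := by
    refine (Metric.isBounded_closedBall (x := y) (r := (g s₀).toReal)).subset fun s hs => ?_
    rw [Metric.mem_closedBall, dist_comm, dist_edist]
    exact ENNReal.toReal_mono (hg' _) ((hg s).trans hs)
  obtain ⟨s, hs, hmin⟩ := Set.exists_min_image _ g (hfin _ hB) ⟨s₀, hs₀, le_refl (g s₀)⟩
  refine ⟨s, hs.1, fun t ht => ?_⟩
  by_cases h : g t ≤ g s₀
  · exact hmin t ⟨ht, h⟩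
  · exact (hmin s₀ ⟨hs₀, le_refl (g s₀)⟩).trans (not_le.1 h).le

theorem exists_nearest {S : Set (Space d)} (hne : S.Nonempty)
    (hfin : ∀ B, Bornology.IsBounded B → (S ∩ B).Finite) (y : Space d) :
    ∃ s ∈ S, edist y s = Metric.infEDist y S := by
  obtain ⟨s, hs, h⟩ := exists_forall_le_of_locallyFinite hne hfin (y := y) (g := fun s => edist y s)
    (fun s => le_rfl) fun s => edist_ne_top _ _
  exact ⟨s, hs, le_antisymm (le_iInf₂ h) (Metric.infEDist_le_edist_of_mem hs)⟩

theorem shareNucleus_iff {S : Set (Space d)} (hne : S.Nonempty)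
    (hfin : ∀ B, Bornology.IsBounded B → (S ∩ B).Finite) {x y : Space d} :
    ShareNucleus S x y ↔
      ∃ s ∈ S, edist x s = Metric.infEDist x S ∧ edist y s = Metric.infEDist y S := by
  constructor
  · intro h
    obtain ⟨s, hs, hmin⟩ := exists_forall_le_of_locallyFinite hne hfin (y := x)
      (g := fun s => edist x s + edist y s) (fun s => le_self_add)
      fun s => ENNReal.add_ne_top.2 ⟨edist_ne_top _ _, edist_ne_top _ _⟩
    have hle : edist x s + edist y s ≤ Metric.infEDist x S + Metric.infEDist y S := by
      rw [← h]
      exact le_iInf₂ hmin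
    have hx := Metric.infEDist_le_edist_of_mem (x := x) hs
    have hy := Metric.infEDist_le_edist_of_mem (x := y) hs
    refine ⟨s, hs, le_antisymm ?_ hx, le_antisymm ?_ hy⟩
    · have := hle.trans (add_le_add_right hy _)
      exact (ENNReal.add_le_add_iff_right (edist_ne_top _ _)).1 this
    · have := hle.trans (add_le_add_left hx _)
      exact (ENNReal.add_le_add_iff_left (edist_ne_top _ _)).1 this
  · rintro ⟨s, hs, hx, hy⟩
    refine le_antisymm ?_ ?_
    · rw [← hx, ← hy]
      exact iInf₂_le s hs
    · exact le_iInf₂ fun t ht => add_le_add (Metric.infEDist_le_edist_of_mem ht)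
        (Metric.infEDist_le_edist_of_mem ht)

theorem shareNucleus_comm {S : Set (Space d)} {x y : Space d} :
    ShareNucleus S x y ↔ ShareNucleus S y x := by
  simp only [ShareNucleus, pairDist, add_comm (edist x _), add_comm (Metric.infEDist x S)]

/-- `y` has two distinct nearest points in `S`: some set of a countable basis separates two of
them. Using a basis makes the relation measurable in `(y, S)`. -/
def NearestTie (S : Set (Space d)) (y : Space d) : Prop :=
  ∃ U ∈ TopologicalSpace.countableBasis (Space d),
    Metric.infEDist y (S ∩ U) = Metric.infEDist y (S ∩ Uᶜ)

theorem measurableSet_nearestTie :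
    MeasurableSet {p : Space d × Config d | NearestTie p.2.points p.1} := by
  have : {p : Space d × Config d | NearestTie p.2.points p.1} =
      ⋃ U ∈ TopologicalSpace.countableBasis (Space d), {p : Space d × Config d |
        Metric.infEDist p.1 (p.2.points ∩ U) = Metric.infEDist p.1 (p.2.points ∩ Uᶜ)} := by
    ext p
    simp [NearestTie]
  rw [this]
  refine MeasurableSet.biUnion (TopologicalSpace.countable_countableBasis _) fun U hU => ?_
  have hU' : MeasurableSet U := (TopologicalSpace.isOpen_of_mem_countableBasis hU).measurableSet
  exact measurableSet_eq_fun (measurable_infEDist_inter hU') (measurable_infEDist_inter hU'.compl)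

theorem nearestTie_iff {S : Set (Space d)} (hne : S.Nonempty)
    (hfin : ∀ B, Bornology.IsBounded B → (S ∩ B).Finite) {y : Space d} :
    NearestTie S y ↔ ∃ a ∈ S, ∃ b ∈ S, a ≠ b ∧
      edist y a = Metric.infEDist y S ∧ edist y b = Metric.infEDist y S := by
  constructor
  · rintro ⟨U, -, h⟩
    have hfin' : ∀ F B : Set (Space d), Bornology.IsBounded B → (S ∩ F ∩ B).Finite :=
      fun F B hB =>
      (hfin B hB).subset (Set.inter_subset_inter_left _ Set.inter_subset_left)
    have hS : Metric.infEDist y S =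
        min (Metric.infEDist y (S ∩ U)) (Metric.infEDist y (S ∩ Uᶜ)) := by
      rw [← Metric.infEDist_union, Set.inter_union_compl]
    have h1 : Metric.infEDist y (S ∩ U) = Metric.infEDist y S := by rw [hS, ← h, min_self]
    have h2 : Metric.infEDist y (S ∩ Uᶜ) = Metric.infEDist y S := by rw [hS, ← h, min_self]
    -- an empty set has infinite distance from `y`, so neither side of the separation is empty
    have hne' : ∀ F, Metric.infEDist y (S ∩ F) = Metric.infEDist y S → (S ∩ F).Nonempty := by
      intro F hF
      by_contra hemp
      rw [Set.not_nonempty_iff_eq_empty] at hemp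
      rw [hemp, Metric.infEDist_empty] at hF
      exact Metric.infEDist_ne_top hne hF.symm
    obtain ⟨a, ha, ha'⟩ := exists_nearest (hne' U h1) (hfin' U) y
    obtain ⟨b, hb, hb'⟩ := exists_nearest (hne' Uᶜ h2) (hfin' Uᶜ) y
    exact ⟨a, ha.1, b, hb.1, fun hab => hb.2 (hab ▸ ha.2), ha'.trans h1, hb'.trans h2⟩
  · rintro ⟨a, ha, b, hb, hab, ha', hb'⟩
    obtain ⟨U, hU, haU, hUb⟩ :=
      (TopologicalSpace.isBasis_countableBasis (Space d)).exists_subset_of_mem_open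
        (show a ∈ ({b}ᶜ : Set (Space d)) from hab) isOpen_compl_singleton
    have hbU : b ∈ Uᶜ := fun h => hUb h rfl
    have key : ∀ F c, c ∈ S → c ∈ F → edist y c = Metric.infEDist y S →
        Metric.infEDist y (S ∩ F) = Metric.infEDist y S := fun F c hc hcF h =>
      le_antisymm (h ▸ Metric.infEDist_le_edist_of_mem ⟨hc, hcF⟩)
        (Metric.infEDist_anti Set.inter_subset_left)
    exact ⟨U, hU, (key U a ha haU ha').trans (key Uᶜ b hb hbU hb').symm⟩

/-- Ties occur on countably many bisecting hyperplanes. -/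
theorem volume_nearestTie {S : Set (Space d)} (hne : S.Nonempty)
    (hfin : ∀ B, Bornology.IsBounded B → (S ∩ B).Finite) :
    volume {y | NearestTie S y} = 0 := by
  have hc : S.Countable := by
    rw [← Set.inter_univ S, ← Metric.iUnion_ball_nat (0 : Space d), Set.inter_iUnion]
    exact Set.countable_iUnion fun n => (hfin _ Metric.isBounded_ball).countable
  have hsub : {y | NearestTie S y} ⊆
      ⋃ a ∈ S, ⋃ b ∈ S \ {a}, (AffineSubspace.perpBisector a b : Set (Space d)) := by
    intro y hy
    obtain ⟨a, ha, b, hb, hab, ha', hb'⟩ := (nearestTie_iff hne hfin).1 hy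
    simp only [Set.mem_iUnion]
    refine ⟨a, ha, b, ⟨hb, fun h => hab h.symm⟩, ?_⟩
    rw [SetLike.mem_coe, AffineSubspace.mem_perpBisector_iff_dist_eq, dist_edist, dist_edist,
      ha', hb']
  refine measure_mono_null hsub ?_
  refine (measure_biUnion_null_iff hc).2 fun a _ =>
    (measure_biUnion_null_iff (hc.mono Set.sdiff_subset)).2 fun b hb => ?_
  refine Measure.addHaar_affineSubspace _ _ fun h => hb.2 ?_
  exact (AffineSubspace.perpBisector_eq_top.1 h).symm

/-! ### The 0-cell -/

theorem mem_voronoiCell_iff {S : Set (Space d)} {x y : Space d} (hx : x ∈ S) :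
    y ∈ voronoiCell S x ↔ edist y x = Metric.infEDist y S := by
  have h : ∀ s, ‖y - x‖ ≤ ‖s - y‖ ↔ edist y x ≤ edist y s := fun s => by
    rw [norm_sub_rev s y, ← dist_eq_norm, ← dist_eq_norm, edist_dist, edist_dist,
      ENNReal.ofReal_le_ofReal_iff dist_nonneg]
  refine ⟨fun hy => le_antisymm (le_iInf₂ fun s hs => (h s).1 (hy s hs))
    (Metric.infEDist_le_edist_of_mem hx), fun hy s hs => (h s).2 ?_⟩
  exact hy ▸ Metric.infEDist_le_edist_of_mem hs

theorem existsUnique_nucleus {S : Set (Space d)} (hne : S.Nonempty)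
    (hfin : ∀ B, Bornology.IsBounded B → (S ∩ B).Finite) (h0 : ¬ NearestTie S 0) :
    ∃! x, x ∈ S ∧ (0 : Space d) ∈ voronoiCell S x := by
  obtain ⟨s, hs, h⟩ := exists_nearest hne hfin 0
  refine ⟨s, ⟨hs, (mem_voronoiCell_iff hs).2 h⟩, fun t ht => ?_⟩
  by_contra hne'
  exact h0 ((nearestTie_iff hne hfin).2
    ⟨t, ht.1, s, hs, hne', (mem_voronoiCell_iff ht.1).1 ht.2, h⟩)

theorem zeroNucleus_spec {S : Set (Space d)} (hne : S.Nonempty)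
    (hfin : ∀ B, Bornology.IsBounded B → (S ∩ B).Finite) :
    zeroNucleus S ∈ S ∧ (0 : Space d) ∈ voronoiCell S (zeroNucleus S) := by
  have h : ∃ x, x ∈ S ∧ (0 : Space d) ∈ voronoiCell S x := by
    obtain ⟨s, hs, h⟩ := exists_nearest hne hfin 0
    exact ⟨s, hs, (mem_voronoiCell_iff hs).2 h⟩
  rw [zeroNucleus, dif_pos h]
  exact h.choose_spec

/-- Points that share a nucleus with a point without ties are those nearest to that nucleus. -/
theorem shareNucleus_iff_of_not_nearestTie {S : Set (Space d)} (hne : S.Nonempty)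
    (hfin : ∀ B, Bornology.IsBounded B → (S ∩ B).Finite) {x y s : Space d} (hx : ¬ NearestTie S x)
    (hs : s ∈ S) (hxs : edist x s = Metric.infEDist x S) :
    ShareNucleus S x y ↔ edist y s = Metric.infEDist y S := by
  rw [shareNucleus_iff hne hfin]
  refine ⟨fun ⟨t, ht, hxt, hyt⟩ => ?_, fun h => ⟨s, hs, hxs, h⟩⟩
  have : s = t := by
    by_contra hst
    exact hx ((nearestTie_iff hne hfin).2 ⟨s, hs, t, ht, hst, hxs, hxt⟩)
  rwa [this]

theorem zeroCell_eq {S : Set (Space d)} (hne : S.Nonempty)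
    (hfin : ∀ B, Bornology.IsBounded B → (S ∩ B).Finite) (h0 : ¬ NearestTie S 0) :
    zeroCell S = {y | ShareNucleus S 0 y} := by
  obtain ⟨hs, h⟩ := zeroNucleus_spec hne hfin
  ext y
  exact (mem_voronoiCell_iff hs).trans (shareNucleus_iff_of_not_nearestTie hne hfin h0 hs
    ((mem_voronoiCell_iff hs).1 h)).symm

theorem cellVolume_eq_of_shareNucleus {S : Set (Space d)} (hne : S.Nonempty)
    (hfin : ∀ B, Bornology.IsBounded B → (S ∩ B).Finite) {x y : Space d} (hx : ¬ NearestTie S x)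
    (hy : ¬ NearestTie S y) (hxy : ShareNucleus S x y) : cellVolume S x = cellVolume S y := by
  obtain ⟨s, hs, hxs, hys⟩ := (shareNucleus_iff hne hfin).1 hxy
  have : {z | ShareNucleus S x z} = {z | ShareNucleus S y z} := by
    ext z
    exact (shareNucleus_iff_of_not_nearestTie hne hfin hx hs hxs).trans
      (shareNucleus_iff_of_not_nearestTie hne hfin hy hs hys).symm
  rw [cellVolume, cellVolume, this]

theorem volume_voronoiCell_pos {S : Set (Space d)}
    (hfin : ∀ B, Bornology.IsBounded B → (S ∩ B).Finite) (x : Space d) :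
    0 < volume (voronoiCell S x) := by
  have hopen : IsOpen ((S ∩ Metric.ball x 1) \ {x})ᶜ :=
    ((hfin _ Metric.isBounded_ball).subset Set.sdiff_subset).isClosed.isOpen_compl
  obtain ⟨ε, hε, hball⟩ := Metric.isOpen_iff.1 hopen x (fun h => h.2 rfl)
  have hr : 0 < min ε 1 / 2 := by positivity
  refine (Metric.measure_ball_pos volume x hr).trans_le (measure_mono fun y hy s hs => ?_)
  rw [← dist_eq_norm, ← dist_eq_norm]
  by_cases hsx : s = x
  · rw [hsx, dist_comm]
  have hsx' : min ε 1 ≤ dist s x := by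
    by_contra hlt
    rw [not_le, lt_min_iff] at hlt
    exact hball hlt.1 ⟨⟨hs, hlt.2⟩, hsx⟩
  have := dist_triangle s y x
  have hy' : dist y x < min ε 1 / 2 := hy
  linarith

theorem cellVolume_zero_pos {S : Set (Space d)} (hne : S.Nonempty)
    (hfin : ∀ B, Bornology.IsBounded B → (S ∩ B).Finite) (h0 : ¬ NearestTie S 0) :
    0 < cellVolume S 0 := by
  rw [cellVolume, ← zeroCell_eq hne hfin h0]
  exact volume_voronoiCell_pos hfin _

theorem measurableSet_shareNucleus_right (S : Set (Space d)) (x : Space d) :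
    MeasurableSet {y | ShareNucleus S x y} :=
  measurableSet_shareNucleus.preimage (by fun_prop :
    Measurable fun y : Space d => (((x, y), Config.mk S) : (Space d × Space d) × Config d))

/-- The mass received by the origin from all points `x`, each spreading a unit mass uniformly over
its cell, is one. -/
theorem lintegral_cellDensity_zero {S : Set (Space d)} (hne : S.Nonempty)
    (hfin : ∀ B, Bornology.IsBounded B → (S ∩ B).Finite) (h0 : ¬ NearestTie S 0)
    (htop : cellVolume S 0 ≠ ⊤) : ∫⁻ x, cellDensity S x 0 = 1 := by
  classical
  have : (fun x => cellDensity S x 0) =ᵐ[volume]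
      {x | ShareNucleus S 0 x}.indicator fun _ => (cellVolume S 0)⁻¹ := by
    have hae : ∀ᵐ x, ¬ NearestTie S x :=
      measure_eq_zero_iff_ae_notMem.1 (volume_nearestTie hne hfin)
    filter_upwards [hae] with x hx
    by_cases h : ShareNucleus S 0 x
    · rw [Set.indicator_of_mem (by exact h), cellDensity, if_pos (shareNucleus_comm.1 h),
        cellVolume_eq_of_shareNucleus hne hfin h0 hx h]
    · rw [Set.indicator_of_notMem (by exact h), cellDensity,
        if_neg fun h' => h (shareNucleus_comm.1 h')]
  rw [lintegral_congr_ae this, lintegral_indicator_const (measurableSet_shareNucleus_right S 0)]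
  exact ENNReal.inv_mul_cancel (cellVolume_zero_pos hne hfin h0).ne' htop

/-! ### Stationarity of the Poisson process -/

theorem measurable_encard_inter {B : Set (Space d)} (hB : MeasurableSet B)
    (hB' : Bornology.IsBounded B) :
    Measurable[configSigma d] fun S : Set (Space d) => (S ∩ B).encard :=
  (comap_measurable _).mono (le_iSup_of_le B (le_iSup_of_le hB (le_iSup_of_le hB' le_rfl))) le_rfl

theorem measurable_config_sigmaOf {Ω : Type*} (Φ : Ω → Set (Space d)) :
    Measurable[sigmaOf Φ] fun ω => Config.mk (Φ ω) := by
  refine @measurable_generateFrom _ _ (sigmaOf Φ) _ _ ?_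
  rintro _ ⟨B, hB, hB', rfl⟩
  refine ⟨{S | S ∩ B = ∅}, ?_, rfl⟩
  have : {S : Set (Space d) | S ∩ B = ∅} = (fun S : Set (Space d) => (S ∩ B).encard) ⁻¹' {0} := by
    ext S
    simp
  rw [this]
  exact measurable_encard_inter hB hB' (measurableSet_singleton 0)

variable {Ω : Type*} [MeasurableSpace Ω] {P : Measure Ω} {Φ : Ω → Set (Space d)} {l : ℝ≥0}

theorem IsHomogeneousPPP.measurable_config (hΦ : IsHomogeneousPPP P Φ l) :
    Measurable fun ω => Config.mk (Φ ω) :=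
  (measurable_config_sigmaOf Φ).mono hΦ.measurable le_rfl

theorem IsHomogeneousPPP.measure_void (hΦ : IsHomogeneousPPP P Φ l) {B : Set (Space d)}
    (hB : MeasurableSet B) (hB' : Bornology.IsBounded B) :
    P {ω | Φ ω ∩ B = ∅} = ENNReal.ofReal (Real.exp (-(l * (volume B).toReal))) := by
  have hm : Measurable fun ω => (Φ ω ∩ B).encard :=
    ((measurable_encard_inter hB hB').comp (comap_measurable Φ)).mono hΦ.measurable le_rfl
  have h := congrArg (fun μ => μ {(0 : ℕ∞)}) (hΦ.law_count B hB hB')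
  rw [Measure.map_apply hm (measurableSet_singleton 0),
    Measure.map_apply (measurable_of_countable _) (measurableSet_singleton 0)] at h
  have h0 : (Nat.cast : ℕ → ℕ∞) ⁻¹' {0} = {0} := by
    ext n
    simp
  have h1 : (fun ω => (Φ ω ∩ B).encard) ⁻¹' {0} = {ω | Φ ω ∩ B = ∅} := by
    ext ω
    simp
  rw [h0, h1, poissonMeasure_singleton] at h
  simpa [ENNReal.toReal] using h

theorem IsHomogeneousPPP.measurable_config_shift (hΦ : IsHomogeneousPPP P Φ l) (z : Space d) :
    Measurable fun ω => Config.mk (shift z (Φ ω)) :=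
  (measurable_shift z).comp hΦ.measurable_config

/-- The law of `Φ` on `Config d` is determined by its void probabilities, which are translation
invariant. -/
theorem IsHomogeneousPPP.map_shift [IsProbabilityMeasure P] (hΦ : IsHomogeneousPPP P Φ l)
    (z : Space d) :
    P.map (fun ω => Config.mk (shift z (Φ ω))) = P.map (fun ω => Config.mk (Φ ω)) := by
  have hm := hΦ.measurable_config
  have hm' := hΦ.measurable_config_shift z
  have := Measure.isProbabilityMeasure_map (μ := P) hm'.aemeasurable
  have := Measure.isProbabilityMeasure_map (μ := P) hm.aemeasurable
  refine ext_of_generate_finite (voidEvents d) rfl isPiSystem_voidEvents ?_ (by simp)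
  rintro _ ⟨B, hB, hB', rfl⟩
  rw [Measure.map_apply hm' (measurableSet_void hB), Measure.map_apply hm (measurableSet_void hB)]
  have h1 : (fun ω => Config.mk (shift z (Φ ω))) ⁻¹' {S : Config d | S.points ∩ B = ∅} =
      {ω | Φ ω ∩ ((fun s => s - z) ⁻¹' B) = ∅} := by
    ext ω
    exact shift_inter_eq_empty z (Φ ω) B
  have h2 : Bornology.IsBounded ((fun s => s - z) ⁻¹' B) := by
    have : (fun s => s - z) ⁻¹' B = (fun s => s + z) '' B := by
      ext s
      simp [sub_eq_add_neg]
    rw [this]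
    exact (isometry_add_right z).lipschitz.isBounded_image hB'
  have h3 : volume ((fun s => s - z) ⁻¹' B) = volume B := by
    simp only [sub_eq_add_neg]
    exact measure_preimage_add_right volume (-z) B
  rw [h1, hΦ.measure_void (hB.preimage (by fun_prop)) h2, h3]
  exact (hΦ.measure_void hB hB').symm

theorem IsHomogeneousPPP.lintegral_shift [IsProbabilityMeasure P] (hΦ : IsHomogeneousPPP P Φ l)
    (z : Space d) {F : Config d → ℝ≥0∞} (hF : Measurable F) :
    ∫⁻ ω, F ⟨shift z (Φ ω)⟩ ∂P = ∫⁻ ω, F ⟨Φ ω⟩ ∂P := by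
  rw [← lintegral_map hF hΦ.measurable_config, ← hΦ.map_shift z,
    lintegral_map hF (hΦ.measurable_config_shift z)]

theorem IsHomogeneousPPP.ae_shift_iff [IsProbabilityMeasure P] (hΦ : IsHomogeneousPPP P Φ l)
    (z : Space d) {p : Config d → Prop} (hp : MeasurableSet {S | p S}) :
    (∀ᵐ ω ∂P, p ⟨shift z (Φ ω)⟩) ↔ ∀ᵐ ω ∂P, p ⟨Φ ω⟩ := by
  rw [← ae_map_iff hΦ.measurable_config.aemeasurable hp, ← hΦ.map_shift z,
    ae_map_iff (hΦ.measurable_config_shift z).aemeasurable hp]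

theorem volume_ball_eq (hd : 1 ≤ d) (x : Space d) (r : ℝ) :
    volume (Metric.ball x r) = ENNReal.ofReal r ^ d * ENNReal.ofReal (kappa d) := by
  have : Nonempty (Fin d) := Fin.pos_iff_nonempty.1 hd
  rw [EuclideanSpace.volume_ball, Fintype.card_fin, kappa, Real.sqrt_eq_rpow,
    ← Real.rpow_natCast, ← Real.rpow_mul Real.pi_pos.le]
  congr 4
  ring

theorem volume_closedBall_eq (hd : 1 ≤ d) (x : Space d) (r : ℝ) :
    volume (Metric.closedBall x r) = ENNReal.ofReal r ^ d * ENNReal.ofReal (kappa d) := by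
  have : Nonempty (Fin d) := Fin.pos_iff_nonempty.1 hd
  rw [Measure.addHaar_closedBall_eq_addHaar_ball, volume_ball_eq hd]

theorem kappa_pos (d : ℕ) : 0 < kappa d :=
  div_pos (Real.rpow_pos_of_pos Real.pi_pos _) (Real.Gamma_pos_of_pos (by positivity))

theorem IsHomogeneousPPP.measure_void_ball (hΦ : IsHomogeneousPPP P Φ l) (hd : 1 ≤ d)
    (x : Space d) {r : ℝ} (hr : 0 ≤ r) :
    P {ω | Φ ω ∩ Metric.ball x r = ∅} =
      ENNReal.ofReal (Real.exp (-(l : ℝ) * kappa d * r ^ d)) := by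
  rw [hΦ.measure_void measurableSet_ball Metric.isBounded_ball, volume_ball_eq hd]
  simp only [ENNReal.toReal_mul, ENNReal.toReal_pow, ENNReal.toReal_ofReal hr,
    ENNReal.toReal_ofReal (kappa_pos d).le]
  congr 2
  ring

theorem IsHomogeneousPPP.measure_void_closedBall (hΦ : IsHomogeneousPPP P Φ l) (hd : 1 ≤ d)
    (x : Space d) {r : ℝ} (hr : 0 ≤ r) :
    P {ω | Φ ω ∩ Metric.closedBall x r = ∅} =
      ENNReal.ofReal (Real.exp (-(l : ℝ) * kappa d * r ^ d)) := by
  rw [hΦ.measure_void measurableSet_closedBall Metric.isBounded_closedBall, volume_closedBall_eq hd]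
  simp only [ENNReal.toReal_mul, ENNReal.toReal_pow, ENNReal.toReal_ofReal hr,
    ENNReal.toReal_ofReal (kappa_pos d).le]
  congr 2
  ring

theorem IsHomogeneousPPP.ae_nonempty (hΦ : IsHomogeneousPPP P Φ l) (hd : 1 ≤ d) (hl : 0 < l) :
    ∀ᵐ ω ∂P, (Φ ω).Nonempty := by
  have hle : ∀ n : ℕ, P {ω | ¬ (Φ ω).Nonempty} ≤
      ENNReal.ofReal (Real.exp (-(l : ℝ) * kappa d * (n : ℝ) ^ d)) := fun n => by
    rw [← hΦ.measure_void_ball hd 0 n.cast_nonneg]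
    refine measure_mono fun ω hω => ?_
    have : Φ ω = ∅ := Set.not_nonempty_iff_eq_empty.1 hω
    change Φ ω ∩ _ = ∅
    rw [this, Set.empty_inter]
  have hlim : Filter.Tendsto
      (fun n : ℕ => ENNReal.ofReal (Real.exp (-(l : ℝ) * kappa d * (n : ℝ) ^ d)))
      Filter.atTop (nhds 0) := by
    rw [← ENNReal.ofReal_zero]
    refine ENNReal.tendsto_ofReal (Real.tendsto_exp_atBot.comp ?_)
    refine Filter.Tendsto.const_mul_atTop_of_neg ?_
      ((Filter.tendsto_pow_atTop (by omega)).comp tendsto_natCast_atTop_atTop)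
    have := mul_pos (NNReal.coe_pos.2 hl) (kappa_pos d)
    linarith
  exact le_antisymm (ge_of_tendsto' hlim hle) zero_le

/-! ### Almost sure properties of the 0-cell -/

/-- By stationarity the origin is a tie with the same probability as any other point, and almost
every point is almost surely not a tie. -/
theorem IsHomogeneousPPP.ae_not_nearestTie_zero [IsProbabilityMeasure P]
    (hΦ : IsHomogeneousPPP P Φ l) (hd : 1 ≤ d) (hl : 0 < l) :
    ∀ᵐ ω ∂P, ¬ NearestTie (Φ ω) 0 := by
  have hm := hΦ.measurable_config
  have hne := hΦ.ae_nonempty hd hl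
  have hfin := hΦ.locallyFinite
  have hmeas : MeasurableSet {p : Ω × Space d | ¬ NearestTie (Φ p.1) p.2} :=
    (measurableSet_nearestTie.preimage
      (measurable_snd.prodMk (hm.comp measurable_fst))).compl
  have hae : ∀ᵐ ω ∂P, ∀ᵐ y : Space d, ¬ NearestTie (Φ ω) y := by
    filter_upwards [hne, hfin] with ω h1 h2
    exact measure_eq_zero_iff_ae_notMem.1 (volume_nearestTie h1 h2)
  rw [Measure.ae_ae_comm hmeas] at hae
  obtain ⟨z, hz⟩ := hae.exists
  have hset : ∀ y, MeasurableSet {S : Config d | NearestTie S.points y} := fun y =>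
    measurableSet_nearestTie.preimage (by fun_prop : Measurable fun S : Config d => (y, S))
  refine (hΦ.ae_shift_iff z (hset 0).compl).1 ?_
  filter_upwards [hz, hne, hfin] with ω h h1 h2 hmem
  -- translating the separating basis set need not give a basis set, two tied points do translate
  have h1' : (shift z (Φ ω)).Nonempty := by
    obtain ⟨s, hs⟩ := h1
    exact ⟨s - z, by simpa [shift] using hs⟩
  have h2' : ∀ B, Bornology.IsBounded B → (shift z (Φ ω) ∩ B).Finite := fun B hB => by
    refine Set.Finite.of_finite_image (f := fun s => s + z) ((h2 ((fun s => s + z) '' B)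
      ((isometry_add_right z).lipschitz.isBounded_image hB)).subset ?_)
      (add_left_injective z).injOn
    rintro _ ⟨s, hs, rfl⟩
    exact ⟨hs.1, s, hs.2, rfl⟩
  obtain ⟨a, ha, b, hb, hab, ha', hb'⟩ := (nearestTie_iff h1' h2').1 hmem
  rw [infEDist_shift, zero_add] at ha' hb'
  refine h ((nearestTie_iff h1 h2).2
    ⟨a + z, ha, b + z, hb, fun h => hab (add_left_injective z h), ?_, ?_⟩)
  · rw [← ha', ← edist_add_right 0 a z, zero_add]
  · rw [← hb', ← edist_add_right 0 b z, zero_add]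

theorem edist_le_of_shareNucleus {S : Set (Space d)} {x y : Space d} (h : ShareNucleus S x y) :
    edist x y ≤ Metric.infEDist x S + Metric.infEDist y S := by
  rw [← h]
  exact le_iInf₂ fun s _ => edist_triangle_right x y s

theorem inter_ball_eq_empty {S : Set (Space d)} {y : Space d} {r : ℝ}
    (h : ENNReal.ofReal r ≤ Metric.infEDist y S) : S ∩ Metric.ball y r = ∅ := by
  refine Set.eq_empty_of_forall_notMem fun s hs => ?_
  have h1 : ENNReal.ofReal r ≤ edist y s := h.trans (Metric.infEDist_le_edist_of_mem hs.1)
  have h2 : dist s y < r := hs.2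
  have h3 : 0 < r := dist_nonneg.trans_lt h2
  rw [edist_comm, edist_dist, ENNReal.ofReal_le_ofReal_iff dist_nonneg] at h1
  linarith

theorem integrable_exp_neg_mul_norm_pow (hd : 1 ≤ d) {c : ℝ} (hc : 0 < c) :
    Integrable fun y : Space d => Real.exp (-c * ‖y‖ ^ d) := by
  have : Nonempty (Fin d) := Fin.pos_iff_nonempty.1 hd
  rw [integrable_fun_norm_addHaar volume (f := fun t => Real.exp (-c * t ^ d))]
  have h := integrableOn_rpow_mul_exp_neg_mul_rpow (p := d) (s := ((d - 1 : ℕ) : ℝ)) (b := c)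
    (by have : (0 : ℝ) ≤ ((d - 1 : ℕ) : ℝ) := Nat.cast_nonneg _
        linarith) (by exact_mod_cast hd) hc
  simpa only [Real.rpow_natCast, finrank_euclideanSpace, Fintype.card_fin, smul_eq_mul] using h

/-- If `0` and `y` share a nucleus, one of the balls of radius `‖y‖ / 2` around them is void. -/
theorem IsHomogeneousPPP.measure_shareNucleus_le (hΦ : IsHomogeneousPPP P Φ l) (hd : 1 ≤ d)
    (y : Space d) : P {ω | ShareNucleus (Φ ω) 0 y} ≤
      2 * ENNReal.ofReal (Real.exp (-(l * kappa d * (1 / 2) ^ d) * ‖y‖ ^ d)) := by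
  have hsub : {ω | ShareNucleus (Φ ω) 0 y} ⊆ {ω | Φ ω ∩ Metric.ball 0 (‖y‖ / 2) = ∅} ∪
      {ω | Φ ω ∩ Metric.ball y (‖y‖ / 2) = ∅} := by
    intro ω hω
    have h := edist_le_of_shareNucleus hω
    by_contra hcon
    simp only [Set.mem_union, not_or, Set.mem_ofPred_eq] at hcon
    have h1 := lt_of_not_ge fun h' => hcon.1 (inter_ball_eq_empty h')
    have h2 := lt_of_not_ge fun h' => hcon.2 (inter_ball_eq_empty h')
    have h3 := h.trans_lt (ENNReal.add_lt_add h1 h2)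
    rw [← ENNReal.ofReal_add (by positivity) (by positivity), add_halves, edist_dist,
      dist_zero_left] at h3
    exact lt_irrefl _ h3
  refine (measure_mono hsub).trans ((measure_union_le _ _).trans ?_)
  rw [hΦ.measure_void_ball hd 0 (by positivity), hΦ.measure_void_ball hd y (by positivity), two_mul]
  have : -(l : ℝ) * kappa d * (‖y‖ / 2) ^ d = -(l * kappa d * (1 / 2) ^ d) * ‖y‖ ^ d := by
    rw [div_eq_mul_one_div, mul_pow]
    ring
  rw [this]

theorem IsHomogeneousPPP.ae_cellVolume_zero_lt_top [IsProbabilityMeasure P]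
    (hΦ : IsHomogeneousPPP P Φ l) (hd : 1 ≤ d) (hl : 0 < l) :
    ∀ᵐ ω ∂P, cellVolume (Φ ω) 0 < ⊤ := by
  have hm := hΦ.measurable_config
  have hmeas : MeasurableSet {p : Ω × Space d | ShareNucleus (Φ p.1) 0 p.2} :=
    measurableSet_shareNucleus.preimage
      ((measurable_const.prodMk measurable_snd).prodMk (hm.comp measurable_fst))
  refine ae_lt_top (measurable_measure_prodMk_left hmeas) ?_
  -- the expected volume of the 0-cell is finite
  have hprod : ∫⁻ ω, cellVolume (Φ ω) 0 ∂P = ∫⁻ y, P {ω | ShareNucleus (Φ ω) 0 y} :=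
    (Measure.prod_apply hmeas).symm.trans (Measure.prod_apply_symm hmeas)
  refine ne_of_lt (hprod.trans_lt ((lintegral_mono (hΦ.measure_shareNucleus_le hd)).trans_lt ?_))
  rw [lintegral_const_mul' _ _ (by simp)]
  have := (integrable_exp_neg_mul_norm_pow hd (c := l * kappa d * (1 / 2) ^ d)
    (mul_pos (mul_pos (NNReal.coe_pos.2 hl) (kappa_pos d)) (by positivity))).lintegral_lt_top
  exact ENNReal.mul_lt_top (by simp) this

/-! ### Joint law of the process and the uniform point -/

theorem measurable_cellDensity_zero :
    Measurable fun p : Config d × Space d => cellDensity p.1.points 0 p.2 := by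
  have h : Measurable fun p : Config d × Space d =>
      (((0, p.2), p.1) : (Space d × Space d) × Config d) :=
    (measurable_const.prodMk measurable_snd).prodMk measurable_fst
  have h' := measurable_cellDensity.comp h
  simpa only [Function.comp_def] using h'

theorem setLIntegral_cellDensity (S : Set (Space d)) (x : Space d) (A : Set (Space d)) :
    ∫⁻ y in A, cellDensity S x y = volume (A ∩ {y | ShareNucleus S x y}) / cellVolume S x := by
  classical
  have : cellDensity S x = {y | ShareNucleus S x y}.indicator fun _ => (cellVolume S x)⁻¹ := rfl
  have hm := measurableSet_shareNucleus_right S x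
  rw [this, lintegral_indicator_const hm, Measure.restrict_apply hm, Set.inter_comm, mul_comm,
    div_eq_mul_inv]

/-- The pair `(Φ, Y)` has density `cellDensity S 0 y` with respect to the product of the law of `Φ`
and the Lebesgue measure. -/
theorem IsHomogeneousPPP.map_prodMk_uniform [IsProbabilityMeasure P] (hΦ : IsHomogeneousPPP P Φ l)
    (hd : 1 ≤ d) (hl : 0 < l) {Y : Ω → Space d} (hY : IsUniformInZeroCell P Φ Y) :
    P.map (fun ω => (Config.mk (Φ ω), Y ω)) =
      ((P.map fun ω => Config.mk (Φ ω)).prod volume).withDensity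
        fun p => cellDensity p.1.points 0 p.2 := by
  have hm := hΦ.measurable_config
  have hdens := measurable_cellDensity_zero (d := d)
  have hmY : Measurable fun ω => (Config.mk (Φ ω), Y ω) := hm.prodMk hY.1
  have := Measure.isProbabilityMeasure_map (μ := P) hmY.aemeasurable
  have := Measure.isProbabilityMeasure_map (μ := P) hm.aemeasurable
  refine Measure.ext_prod fun {G A} hG hA => ?_
  set E := (fun ω => Config.mk (Φ ω)) ⁻¹' G
  have hEσ : MeasurableSet[sigmaOf Φ] E := measurable_config_sigmaOf Φ hG
  have hgm : Measurable fun S : Config d => ∫⁻ y in A, cellDensity S.points 0 y :=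
    hdens.lintegral_prod_right' (ν := volume.restrict A)
  have hg1 : ∀ ω, ∫⁻ y in A, cellDensity (Φ ω) 0 y ≤ 1 := fun ω => by
    rw [setLIntegral_cellDensity]
    exact (ENNReal.div_le_div_right (measure_mono Set.inter_subset_right) _).trans
      ENNReal.div_self_le_one
  have hright : (((P.map fun ω => Config.mk (Φ ω)).prod volume).withDensity
        fun p => cellDensity p.1.points 0 p.2) (G ×ˢ A) =
      ∫⁻ ω in E, (∫⁻ y in A, cellDensity (Φ ω) 0 y) ∂P := by
    rw [withDensity_apply _ (hG.prod hA), ← Measure.prod_restrict,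
      lintegral_prod _ hdens.aemeasurable, setLIntegral_map hG hgm hm]
  have hleft : P.map (fun ω => (Config.mk (Φ ω), Y ω)) (G ×ˢ A) = P (Y ⁻¹' A ∩ E) := by
    rw [Measure.map_apply hmY (hG.prod hA), Set.inter_comm]
    rfl
  have hint : Integrable ((Y ⁻¹' A).indicator fun _ => (1 : ℝ)) P :=
    (integrable_const 1).indicator (hY.1 hA)
  have hcond : ∀ᵐ ω ∂P, (P[(Y ⁻¹' A).indicator (fun _ => (1 : ℝ)) | sigmaOf Φ]) ω =
      (∫⁻ y in A, cellDensity (Φ ω) 0 y).toReal := by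
    filter_upwards [hY.2 A hA, hΦ.ae_nonempty hd hl, hΦ.locallyFinite,
      hΦ.ae_not_nearestTie_zero hd hl] with ω h hne hfin h0
    rw [h, zeroCell_eq hne hfin h0, setLIntegral_cellDensity, cellVolume]
  have hset := setIntegral_condExp hΦ.measurable hint hEσ
  rw [integral_indicator_const _ (hY.1 hA), measureReal_restrict_apply (hY.1 hA), smul_eq_mul,
    mul_one, integral_congr_ae (ae_restrict_of_ae hcond),
    integral_toReal (f := fun ω => ∫⁻ y in A, cellDensity (Φ ω) 0 y) (hgm.comp hm).aemeasurable
      (ae_of_all _ fun ω => (hg1 ω).trans_lt ENNReal.one_lt_top), measureReal_def] at hset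
  rw [hleft, hright]
  refine ((ENNReal.toReal_eq_toReal_iff' ?_ (measure_ne_top _ _)).1 hset).symm
  refine ne_top_of_le_ne_top (measure_ne_top P E) ?_
  exact (lintegral_mono hg1).trans (by simp)

theorem IsHomogeneousPPP.lintegral_uniform [IsProbabilityMeasure P] (hΦ : IsHomogeneousPPP P Φ l)
    (hd : 1 ≤ d) (hl : 0 < l) {Y : Ω → Space d} (hY : IsUniformInZeroCell P Φ Y)
    {H : Config d × Space d → ℝ≥0∞} (hH : Measurable H) :
    ∫⁻ ω, H (⟨Φ ω⟩, Y ω) ∂P = ∫⁻ ω, (∫⁻ y, cellDensity (Φ ω) 0 y * H (⟨Φ ω⟩, y)) ∂P := by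
  have hm := hΦ.measurable_config
  have hdens := measurable_cellDensity_zero (d := d)
  have := Measure.isProbabilityMeasure_map (μ := P) hm.aemeasurable
  rw [← lintegral_map (f := H) hH (hm.prodMk hY.1), hΦ.map_prodMk_uniform hd hl hY,
    lintegral_withDensity_eq_lintegral_mul _ hdens hH,
    lintegral_prod _ (hdens.mul hH).aemeasurable,
    lintegral_map (hdens.mul hH).lintegral_prod_right' hm]
  rfl

/-! ### Mass transport -/

/-- The distance to the process has the same law seen from a uniform point of the 0-cell as seen
from the origin. By Tonelli and stationarity the mass sent out from the origin has the same
expectation as the mass it receives. -/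
theorem IsHomogeneousPPP.measure_lt_infEDist_uniform [IsProbabilityMeasure P]
    (hΦ : IsHomogeneousPPP P Φ l) (hd : 1 ≤ d) (hl : 0 < l) {Y : Ω → Space d}
    (hY : IsUniformInZeroCell P Φ Y) (r : ℝ≥0∞) :
    P {ω | r < Metric.infEDist (Y ω) (Φ ω)} = P {ω | r < Metric.infEDist 0 (Φ ω)} := by
  have hm := hΦ.measurable_config
  -- the mass that `x` sends to `y`, if `y` is at distance more than `r` from the configuration
  let T : (Space d × Space d) × Config d → ℝ≥0∞ := fun p =>
    cellDensity p.2.points p.1.1 p.1.2 *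
      {q : Space d × Config d | r < Metric.infEDist q.1 q.2.points}.indicator 1 (p.1.2, p.2)
  have hR : MeasurableSet {q : Space d × Config d | r < Metric.infEDist q.1 q.2.points} :=
    measurableSet_lt measurable_const measurable_infEDist_config
  have hI : Measurable ({q : Space d × Config d | r < Metric.infEDist q.1 q.2.points}.indicator
    (1 : Space d × Config d → ℝ≥0∞)) := measurable_one.indicator hR
  have hT : Measurable T := measurable_cellDensity.mul (hI.comp (by fun_prop))
  have hshift : ∀ z x y (S : Set (Space d)), T ((x, y), ⟨shift z S⟩) = T ((x + z, y + z), ⟨S⟩) := by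
    intro z x y S
    simp only [T, cellDensity_shift, Set.indicator_apply, Set.mem_ofPred_eq, infEDist_shift,
      Pi.one_apply]
  have hone : ∀ (f : Ω → Space d), Measurable f → ∫⁻ ω,
      {q : Space d × Config d | r < Metric.infEDist q.1 q.2.points}.indicator 1 (f ω, ⟨Φ ω⟩) ∂P =
      P {ω | r < Metric.infEDist (f ω) (Φ ω)} := fun f hf =>
    lintegral_indicator_one (hR.preimage (hf.prodMk hm))
  calc P {ω | r < Metric.infEDist (Y ω) (Φ ω)}
      = ∫⁻ ω, (∫⁻ y, T ((0, y), ⟨Φ ω⟩)) ∂P := by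
        rw [← hone Y hY.1]
        exact hΦ.lintegral_uniform hd hl hY (hI.comp measurable_swap)
    _ = ∫⁻ y, ∫⁻ ω, T ((0, y), ⟨Φ ω⟩) ∂P := by
        refine lintegral_lintegral_swap (Measurable.aemeasurable ?_)
        exact hT.comp ((measurable_const.prodMk measurable_snd).prodMk (hm.comp measurable_fst))
    _ = ∫⁻ y, ∫⁻ ω, T ((-y, 0), ⟨Φ ω⟩) ∂P := by
        refine lintegral_congr fun y => ?_
        rw [← hΦ.lintegral_shift y (F := fun S => T ((-y, 0), S)) (hT.comp (by fun_prop))]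
        simp only [hshift, neg_add_cancel, zero_add]
    _ = ∫⁻ y, ∫⁻ ω, T ((y, 0), ⟨Φ ω⟩) ∂P :=
        lintegral_neg_eq_self fun y => ∫⁻ ω, T ((y, 0), ⟨Φ ω⟩) ∂P
    _ = ∫⁻ ω, (∫⁻ y, T ((y, 0), ⟨Φ ω⟩)) ∂P := by
        refine (lintegral_lintegral_swap (Measurable.aemeasurable ?_)).symm
        exact hT.comp ((measurable_snd.prodMk measurable_const).prodMk (hm.comp measurable_fst))
    _ = P {ω | r < Metric.infEDist 0 (Φ ω)} := by
        rw [← hone (fun _ => 0) measurable_const]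
        refine lintegral_congr_ae ?_
        filter_upwards [hΦ.ae_nonempty hd hl, hΦ.locallyFinite, hΦ.ae_not_nearestTie_zero hd hl,
          hΦ.ae_cellVolume_zero_lt_top hd hl] with ω hne hfin h0 htop
        have hmeas : Measurable fun y => cellDensity (Φ ω) y 0 :=
          measurable_cellDensity.comp (by fun_prop : Measurable
            fun y : Space d => (((y, 0), ⟨Φ ω⟩) : (Space d × Space d) × Config d))
        simp only [T]
        rw [lintegral_mul_const _ hmeas, lintegral_cellDensity_zero hne hfin h0 htop.ne, one_mul]

/-- A uniform point of the 0-cell almost surely has the nucleus of that cell as a nearest point. -/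
theorem IsHomogeneousPPP.zeroCellDist_ae_eq [IsProbabilityMeasure P]
    (hΦ : IsHomogeneousPPP P Φ l) (hd : 1 ≤ d) (hl : 0 < l) {Y : Ω → Space d}
    (hY : IsUniformInZeroCell P Φ Y) :
    zeroCellDist Φ Y =ᵐ[P] fun ω => (Metric.infEDist (Y ω) (Φ ω)).toReal := by
  have hN : MeasurableSet {p : Config d × Space d | ¬ ShareNucleus p.1.points 0 p.2} :=
    (measurableSet_shareNucleus.preimage (by fun_prop : Measurable
      fun p : Config d × Space d => (((0, p.2), p.1) : (Space d × Space d) × Config d))).compl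
  have hshare : ∀ᵐ ω ∂P, ShareNucleus (Φ ω) 0 (Y ω) := by
    have h := hΦ.lintegral_uniform hd hl hY (measurable_one.indicator hN)
    have hzero : ∀ S (y : Space d), cellDensity S 0 y *
        {p : Config d × Space d | ¬ ShareNucleus p.1.points 0 p.2}.indicator 1 (⟨S⟩, y) = 0 := by
      intro S y
      by_cases hS : ShareNucleus S 0 y
      · rw [Set.indicator_of_notMem (by simpa using hS), mul_zero]
      · rw [cellDensity, if_neg hS, zero_mul]
    simp only [hzero, lintegral_zero] at h
    have h' : P {ω | ¬ ShareNucleus (Φ ω) 0 (Y ω)} = 0 :=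
      (lintegral_indicator_one (hN.preimage (hΦ.measurable_config.prodMk hY.1))).symm.trans h
    exact h'
  filter_upwards [hshare, hΦ.ae_nonempty hd hl, hΦ.locallyFinite, hΦ.ae_not_nearestTie_zero hd hl]
    with ω h hne hfin h0
  obtain ⟨hs, h0s⟩ := zeroNucleus_spec hne hfin
  have := (shareNucleus_iff_of_not_nearestTie hne hfin h0 hs ((mem_voronoiCell_iff hs).1 h0s)).1 h
  rw [← this, zeroCellDist, ← dist_eq_norm, dist_comm, dist_edist]

theorem lt_infEDist_iff {S : Set (Space d)} (hne : S.Nonempty)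
    (hfin : ∀ B, Bornology.IsBounded B → (S ∩ B).Finite) {y : Space d} {r : ℝ} (hr : 0 ≤ r) :
    ENNReal.ofReal r < Metric.infEDist y S ↔ S ∩ Metric.closedBall y r = ∅ := by
  obtain ⟨s, hs, h⟩ := exists_nearest hne hfin y
  constructor
  · intro hlt
    refine Set.eq_empty_of_forall_notMem fun t ht => ?_
    have h1 := hlt.trans_le (Metric.infEDist_le_edist_of_mem ht.1)
    rw [edist_comm, edist_dist, ENNReal.ofReal_lt_ofReal_iff_of_nonneg hr] at h1
    exact absurd (Metric.mem_closedBall.1 ht.2) (not_le.2 h1)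
  · intro hemp
    rw [← h, edist_comm, edist_dist, ENNReal.ofReal_lt_ofReal_iff_of_nonneg hr]
    by_contra hle
    exact Set.notMem_empty s (hemp ▸ ⟨hs, Metric.mem_closedBall.2 (not_lt.1 hle)⟩)

theorem IsHomogeneousPPP.measure_lt_zeroCellDist [IsProbabilityMeasure P]
    (hΦ : IsHomogeneousPPP P Φ l) (hd : 1 ≤ d) (hl : 0 < l) {Y : Ω → Space d}
    (hY : IsUniformInZeroCell P Φ Y) {r : ℝ} (hr : 0 ≤ r) :
    P {ω | r < zeroCellDist Φ Y ω} =
      ENNReal.ofReal (Real.exp (-(l : ℝ) * kappa d * r ^ d)) := by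
  have h1 : P {ω | r < zeroCellDist Φ Y ω} =
      P {ω | ENNReal.ofReal r < Metric.infEDist (Y ω) (Φ ω)} := by
    refine measure_congr ?_
    filter_upwards [hΦ.zeroCellDist_ae_eq hd hl hY, hΦ.ae_nonempty hd hl] with ω h hne
    refine propext ?_
    change r < zeroCellDist Φ Y ω ↔ _
    rw [h, ← ENNReal.ofReal_lt_iff_lt_toReal hr (Metric.infEDist_ne_top hne)]
    rfl
  have h2 : P {ω | ENNReal.ofReal r < Metric.infEDist 0 (Φ ω)} =
      P {ω | Φ ω ∩ Metric.closedBall 0 r = ∅} := by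
    refine measure_congr ?_
    filter_upwards [hΦ.ae_nonempty hd hl, hΦ.locallyFinite] with ω hne hfin
    exact propext (lt_infEDist_iff hne hfin hr)
  rw [h1, hΦ.measure_lt_infEDist_uniform hd hl hY, h2, hΦ.measure_void_closedBall hd 0 hr]

end PoissonVoronoi

end

theorem mainTheorem1 {d : ℕ} (hd : 1 ≤ d) {l : ℝ≥0} (hl : 0 < l)
    {Ω : Type*} [MeasurableSpace Ω] (P : Measure Ω) [IsProbabilityMeasure P]
    (Φ : Ω → Set (PoissonVoronoi.Space d)) (hΦ : PoissonVoronoi.IsHomogeneousPPP P Φ l)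
    (Y : Ω → PoissonVoronoi.Space d) (hY : PoissonVoronoi.IsUniformInZeroCell P Φ Y) :
    (∀ᵐ ω ∂P, ∃! x, x ∈ Φ ω ∧ (0 : PoissonVoronoi.Space d) ∈ PoissonVoronoi.voronoiCell (Φ ω) x) ∧
    (∀ᵐ ω ∂P, 0 < volume (PoissonVoronoi.zeroCell (Φ ω)) ∧
      volume (PoissonVoronoi.zeroCell (Φ ω)) < ⊤) ∧
    AEMeasurable (PoissonVoronoi.zeroCellDist Φ Y) P ∧
    ∀ r : ℝ, 0 ≤ r →
      cdf (P.map (PoissonVoronoi.zeroCellDist Φ Y)) r =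
        1 - Real.exp (-(l : ℝ) * PoissonVoronoi.kappa d * r ^ d) := by
  have hne := hΦ.ae_nonempty hd hl
  have hfin := hΦ.locallyFinite
  have h0 := hΦ.ae_not_nearestTie_zero hd hl
  have hmeas : AEMeasurable (PoissonVoronoi.zeroCellDist Φ Y) P := by
    have hm : Measurable fun ω => (Metric.infEDist (Y ω) (Φ ω)).toReal :=
      (PoissonVoronoi.measurable_infEDist_config.comp
        (hY.1.prodMk hΦ.measurable_config)).ennreal_toReal
    exact hm.aemeasurable.congr (hΦ.zeroCellDist_ae_eq hd hl hY).symm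
  refine ⟨?_, ?_, hmeas, fun r hr => ?_⟩
  · filter_upwards [hne, hfin, h0] with ω h1 h2 h3
    exact PoissonVoronoi.existsUnique_nucleus h1 h2 h3
  · filter_upwards [hne, hfin, h0, hΦ.ae_cellVolume_zero_lt_top hd hl] with ω h1 h2 h3 h4
    rw [PoissonVoronoi.zeroCell_eq h1 h2 h3]
    exact ⟨PoissonVoronoi.cellVolume_zero_pos h1 h2 h3, h4⟩
  · have := Measure.isProbabilityMeasure_map hmeas
    rw [cdf_eq_real, ← Set.compl_Ioi, probReal_compl_eq_one_sub measurableSet_Ioi, measureReal_def,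
      Measure.map_apply_of_aemeasurable hmeas measurableSet_Ioi]
    have h := hΦ.measure_lt_zeroCellDist hd hl hY hr
    rw [show PoissonVoronoi.zeroCellDist Φ Y ⁻¹' Set.Ioi r =
      {ω | r < PoissonVoronoi.zeroCellDist Φ Y ω} from rfl, h,
      ENNReal.toReal_ofReal (Real.exp_pos _).le]
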